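/- For $n\ge 1$ let $\theta_1<\theta_2<\cdots<\theta_n$ be the zeros in $(0,\pi)$ of $\theta\mapsto P_n(\cos\theta)$, where $P_n$ is the $n$th Legendre polynomial, and for $j=1,\dots,n$ let $\theta_j^0=\frac{2\pi j-\pi/2}{2n+1}$ (the zeros of the Laplace approximation $\sqrt{\tfrac{2}{n\pi\sin\theta}}\cos\big((n+\tfrac12)\theta-\tfrac{\pi}{4}\big)$). Let $I\subseteq(0,\pi)$ be a fixed closed interval and let $U\subseteq\mathbb{C}$ be a fixed open neighbourhood of $I$. Then there are constants $K$ and $N$, depending only on $I$ and $U$, such that for every $n\ge N$ one has $\theta_j^0\in U$ whenever $\theta_j\in I$, and for every bounded analytic function $f$ on $U$ \[\Big|\sum_{j:\,\theta_j\in I}(-1)^jf(\theta_j)-\sum_{j:\,\theta_j\in I}(-1)^jf\Big(\frac{2\pi j-\pi/2}{2n+1}\Big)\Big|\le\frac{K}{n}\,\|f\|_{L^\infty(U)},\qquad \|f\|_{L^\infty(U)}=\sup_{z\in U}|f(z)|.\] -/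

import Mathlib

open Polynomial

/-- The `n`th Legendre polynomial `P_n`, given by the Rodrigues formula
`P_n(x) = (1 / (2 ^ n n!)) (d/dx) ^ n (x ^ 2 - 1) ^ n`. -/
noncomputable def legendreP (n : ℕ) : ℝ[X] :=
  C (1 / (2 ^ n * (n.factorial : ℝ))) * derivative^[n] ((X ^ 2 - 1) ^ n)

/-- The zeros of `θ ↦ P_n(cos θ)` in `(0, π)`. -/
def legendreZeroSet (n : ℕ) : Set ℝ :=
  {t | t ∈ Set.Ioo 0 Real.pi ∧ (legendreP n).eval (Real.cos t) = 0}

/-- Rolle's theorem, for several zeros in `[-1, 1]`. -/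
theorem legendre_rolle (p : ℝ[X]) (m : ℕ) (s : Finset ℝ) (hs : s.card = m + 1)
    (h : ∀ x ∈ s, x ∈ Set.Icc (-1 : ℝ) 1 ∧ p.eval x = 0) :
    ∃ t : Finset ℝ, t.card = m ∧
      ∀ x ∈ t, x ∈ Set.Ioo (-1 : ℝ) 1 ∧ (derivative p).eval x = 0 := by
  set g := s.orderEmbOfFin hs
  have hg : ∀ i, g i ∈ s := fun i => Finset.orderEmbOfFin_mem s hs i
  have key : ∀ i : Fin m, ∃ c ∈ Set.Ioo (g i.castSucc) (g i.succ), (derivative p).eval c = 0 := by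
    intro i
    have hlt : g i.castSucc < g i.succ := g.strictMono (Fin.castSucc_lt_succ)
    obtain ⟨c, hc, hc'⟩ := exists_deriv_eq_zero hlt p.continuous.continuousOn
      ((h _ (hg _)).2.trans (h _ (hg _)).2.symm)
    exact ⟨c, hc, by rwa [Polynomial.deriv] at hc'⟩
  choose c hc hc0 using key
  have hmono : StrictMono c := by
    intro i j hij
    have h1 : g i.succ ≤ g j.castSucc := g.monotone (by
      rw [Fin.le_def]; simpa using hij)
    exact (hc i).2.trans_le (h1.trans (hc j).1.le)
  refine ⟨Finset.univ.map ⟨c, hmono.injective⟩, by simp, ?_⟩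
  intro x hx
  obtain ⟨i, -, rfl⟩ := Finset.mem_map.1 hx
  exact ⟨⟨(h _ (hg i.castSucc)).1.1.trans_lt (hc i).1, (hc i).2.trans_le (h _ (hg i.succ)).1.2⟩,
    hc0 i⟩

theorem legendre_endpoint (n k : ℕ) (hk : k < n) (x : ℝ) (hx : x ^ 2 = 1) :
    (derivative^[k] ((X ^ 2 - 1 : ℝ[X]) ^ n)).eval x = 0 := by
  have h := pow_sub_dvd_iterate_derivative_pow (X ^ 2 - 1 : ℝ[X]) n k
  have h2 := (dvd_pow_self (X ^ 2 - 1 : ℝ[X]) (Nat.sub_ne_zero_of_lt hk)).trans h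
  exact eval_eq_zero_of_dvd_of_eval_eq_zero h2 (by simp [hx])

theorem legendre_interior (n k : ℕ) (hk : k ≤ n) :
    ∃ t : Finset ℝ, t.card = k ∧ ∀ x ∈ t, x ∈ Set.Ioo (-1 : ℝ) 1 ∧
      (derivative^[k] ((X ^ 2 - 1 : ℝ[X]) ^ n)).eval x = 0 := by
  induction k with
  | zero => exact ⟨∅, by simp⟩
  | succ k ih =>
    obtain ⟨t, ht, h⟩ := ih (by omega)
    have h1 : (1 : ℝ) ∉ t := fun hx => lt_irrefl _ (h _ hx).1.2
    have h2 : (-1 : ℝ) ∉ insert 1 t := by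
      intro hx
      rcases Finset.mem_insert.1 hx with hx | hx
      · norm_num at hx
      · exact lt_irrefl _ (h _ hx).1.1
    rw [Function.iterate_succ_apply']
    refine legendre_rolle _ (k + 1) (insert (-1) (insert 1 t))
      (by rw [Finset.card_insert_of_notMem h2, Finset.card_insert_of_notMem h1, ht]) ?_
    intro x hx
    rcases Finset.mem_insert.1 hx with rfl | hx
    · exact ⟨by norm_num, legendre_endpoint n k (by omega) _ (by norm_num)⟩
    rcases Finset.mem_insert.1 hx with rfl | hx
    · exact ⟨by norm_num, legendre_endpoint n k (by omega) _ (by norm_num)⟩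
    · exact ⟨Set.Ioo_subset_Icc_self (h x hx).1, (h x hx).2⟩

theorem legendreP_ne_zero (n : ℕ) : legendreP n ≠ 0 := by
  have hm : ((X ^ 2 - 1 : ℝ[X]) ^ n).Monic := by
    have : (X ^ 2 - 1 : ℝ[X]).Monic := by simpa using monic_X_pow_sub_C (1 : ℝ) two_ne_zero
    exact this.pow n
  have hd : ((X ^ 2 - 1 : ℝ[X]) ^ n).natDegree = n + n := by
    rw [natDegree_pow, show (X ^ 2 - 1 : ℝ[X]) = X ^ 2 - C 1 by simp, natDegree_X_pow_sub_C]
    ring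
  intro h
  have hc : (legendreP n).coeff n = 0 := by rw [h]; simp
  have h1 : ((X ^ 2 - 1 : ℝ[X]) ^ n).coeff (n + n) = 1 := by
    have := hm.coeff_natDegree; rwa [hd] at this
  rw [legendreP, coeff_C_mul, coeff_iterate_derivative, h1] at hc
  have h3 : (n + n).descFactorial n ≠ 0 := by simp [Nat.descFactorial_eq_zero_iff_lt]
  have h4 := n.factorial_ne_zero
  simp [h3, h4] at hc

theorem legendreP_natDegree_le (n : ℕ) : (legendreP n).natDegree ≤ n := by
  refine (natDegree_C_mul_le _ _).trans ((natDegree_iterate_derivative _ _).trans ?_)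
  rw [natDegree_pow, show (X ^ 2 - 1 : ℝ[X]) = X ^ 2 - C 1 by simp, natDegree_X_pow_sub_C]
  omega

theorem legendreZeroSet_eq (n : ℕ) :
    ∃ t : Finset ℝ, t.card = n ∧ (t : Set ℝ) = legendreZeroSet n := by
  obtain ⟨t, ht, h⟩ := legendre_interior n n le_rfl
  have h0 : ∀ x ∈ t, (legendreP n).eval x = 0 := fun x hx => by
    rw [legendreP, eval_mul, (h x hx).2, mul_zero]
  have hsub : t ⊆ (legendreP n).roots.toFinset := fun x hx => by
    simpa [legendreP_ne_zero n] using h0 x hx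
  have heq : t = (legendreP n).roots.toFinset := by
    refine Finset.eq_of_subset_of_card_le hsub ?_
    exact (Multiset.toFinset_card_le _).trans
      ((card_roots' _).trans ((legendreP_natDegree_le n).trans ht.ge))
  refine ⟨t.image Real.arccos, ?_, ?_⟩
  · rw [Finset.card_image_of_injOn, ht]
    exact Real.arccos_injOn.mono fun x hx => Set.Ioo_subset_Icc_self (h x hx).1
  · ext y
    simp only [Finset.coe_image, Set.mem_image, Finset.mem_coe, legendreZeroSet, Set.mem_ofPred_eq]
    constructor
    · rintro ⟨x, hx, rfl⟩
      have hx1 := (h x hx).1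
      refine ⟨⟨Real.arccos_pos.2 hx1.2, ?_⟩, ?_⟩
      · exact lt_of_le_of_ne (Real.arccos_le_pi x) fun e =>
          absurd (Real.arccos_eq_pi.1 e) (not_le.2 hx1.1)
      · rw [Real.cos_arccos hx1.1.le hx1.2.le]
        exact h0 x hx
    · rintro ⟨hy, hy0⟩
      refine ⟨Real.cos y, ?_, Real.arccos_cos hy.1.le hy.2.le⟩
      rw [heq]
      simpa [legendreP_ne_zero n] using hy0

theorem legendreZeroSet_finite (n : ℕ) : (legendreZeroSet n).Finite := by
  obtain ⟨t, -, h⟩ := legendreZeroSet_eq n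
  exact h ▸ t.finite_toSet

theorem legendreZeroSet_card (n : ℕ) : (legendreZeroSet_finite n).toFinset.card = n := by
  obtain ⟨t, ht, h⟩ := legendreZeroSet_eq n
  have : (legendreZeroSet_finite n).toFinset = t := by
    apply Finset.coe_injective
    simp [h]
  rw [this, ht]

/-- The increasing enumeration `θ_1 < ⋯ < θ_n` of the zeros of `P_n(cos θ)` in `(0, π)`.
The index is shifted by one: `legendreZero n i` is `θ_{i + 1}`, for `i = 0, …, n - 1`. -/
noncomputable def legendreZero (n : ℕ) : Fin n ↪o ℝ :=
  (legendreZeroSet_finite n).toFinset.orderEmbOfFin (legendreZeroSet_card n)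

/-- The zero `(2πj - π/2) / (2n + 1)` of the Laplace approximation to `P_n(cos θ)`. -/
noncomputable def laplaceZero (n j : ℕ) : ℝ :=
  (2 * Real.pi * j - Real.pi / 2) / (2 * n + 1)

/-- The supremum norm on `U` of a function that is bounded on `U`. -/
noncomputable def supNormOn (U : Set ℂ) (f : ℂ → ℂ) : ℝ :=
  sSup ((fun z => ‖f z‖) '' U)

/-! The function `u = √(sin θ) P_n(cos θ)` solves `u'' + (w² + 1/(4 sin² θ)) u = 0` with `w = n +
1/2`. Sturm comparison (`sturm_gap_le`, `le_sturm_gap`) puts each gap between consecutive zeros in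
`[c, π - c]` within `O(n⁻³)` of `π/w`.

The reflection `θ ↦ π - θ` anchors the zeros: at most `n` gaps separate a zero from its mirror
image, so their distance is a multiple of `π/w` up to `O(n⁻²)`. The Laplace zeros satisfy the same
relation exactly, whence `θ_j - θ_j^0 = O(n⁻²)`.

Cauchy's estimate for `f'` bounds each difference by `O(‖f‖ n⁻²)`, and there are at most `n` terms.
No cancellation between the signs is needed. -/

/-! ### Legendre's equation and its normal form -/

/-- Differentiate `(x² - 1) y' = 2n x y`, where `y = (x² - 1)^n`, `k + 1` times. The case `k = n` is
Legendre's equation. -/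
theorem iterate_derivative_sq_sub_one_pow_ode (n k : ℕ) :
    (X ^ 2 - 1 : ℝ[X]) * derivative^[k + 2] ((X ^ 2 - 1) ^ n)
      + C (2 * (k + 1) - 2 * n : ℝ) * X * derivative^[k + 1] ((X ^ 2 - 1) ^ n)
      + C ((k + 1) * k - 2 * n * (k + 1) : ℝ) * derivative^[k] ((X ^ 2 - 1) ^ n) = 0 := by
  have hC : (C 2 : ℝ[X]) = 2 := map_ofNat C 2
  induction k with
  | zero =>
    have h1 : (X ^ 2 - 1 : ℝ[X]) * derivative ((X ^ 2 - 1) ^ n)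
        = C (2 * n : ℝ) * X * (X ^ 2 - 1) ^ n := by
      rcases n with _ | n
      · simp
      · rw [derivative_pow]
        simp [hC]
        ring
    have h2 := congrArg derivative h1
    simp only [derivative_mul, derivative_sub, derivative_X_pow, derivative_one, derivative_C,
      derivative_X] at h2
    simp only [Function.iterate_succ_apply', Function.iterate_zero_apply]
    simp [hC] at h2 ⊢
    linear_combination h2
  | succ k ih =>
    have h2 := congrArg derivative ih
    simp only [derivative_add, derivative_mul, derivative_sub, derivative_X_pow, derivative_one,
      derivative_C, derivative_X, ← Function.iterate_succ_apply' (⇑derivative)] at h2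
    simp [hC] at h2 ⊢
    linear_combination h2

/-- Legendre's differential equation. -/
theorem legendreP_ode (n : ℕ) :
    (1 - X ^ 2) * derivative (derivative (legendreP n)) - 2 * X * derivative (legendreP n)
      + C (n * (n + 1) : ℝ) * legendreP n = 0 := by
  have h := iterate_derivative_sq_sub_one_pow_ode n n
  rw [legendreP]
  simp only [derivative_mul, derivative_C, zero_mul, zero_add]
  simp only [Function.iterate_succ_apply'] at h
  have hC : (C 2 : ℝ[X]) = 2 := map_ofNat C 2
  simp [hC] at h ⊢
  linear_combination (-(C (n.factorial : ℝ)⁻¹ * C (2 ^ n : ℝ)⁻¹)) * h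

/-- `(x² - 1)^n` is even, and each derivative flips parity. -/
theorem legendreP_eval_neg_eq_zero {n : ℕ} {x : ℝ} (h : (legendreP n).eval x = 0) :
    (legendreP n).eval (-x) = 0 := by
  have key : ∀ k : ℕ, (derivative^[k] ((X ^ 2 - 1 : ℝ[X]) ^ n)).comp (-X)
      = (-1) ^ k * derivative^[k] ((X ^ 2 - 1 : ℝ[X]) ^ n) := by
    intro k
    induction k with
    | zero => simp
    | succ k ih =>
      have h2 := congrArg derivative ih
      rw [derivative_comp] at h2
      simp only [Function.iterate_succ_apply']
      have h3 : derivative ((-1 : ℝ[X]) ^ k) = 0 := by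
        have : ((-1 : ℝ[X]) ^ k) = C ((-1) ^ k) := by simp
        rw [this, derivative_C]
      rw [derivative_mul, h3] at h2
      simp at h2 ⊢
      linear_combination -h2
  have h1 := congrArg (eval x) (key n)
  rw [eval_comp] at h1
  rw [legendreP, eval_mul] at h ⊢
  have hc : (C (1 / (2 ^ n * (n.factorial : ℝ)))).eval x ≠ 0 := by
    rw [eval_C]; positivity
  have h0 := (mul_eq_zero.1 h).resolve_left hc
  rw [eval_mul, h0, mul_zero] at h1
  simp only [eval_neg, eval_X] at h1
  rw [h1, mul_zero]

/-- The Liouville normal form `√(sin θ) P_n(cos θ)` of the Legendre polynomial. -/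
noncomputable def legendreNormal (n : ℕ) (t : ℝ) : ℝ :=
  √(Real.sin t) * (legendreP n).eval (Real.cos t)

/-- The derivative of `legendreNormal`. -/
noncomputable def legendreNormalDeriv (n : ℕ) (t : ℝ) : ℝ :=
  Real.cos t / (2 * √(Real.sin t)) * (legendreP n).eval (Real.cos t)
    + √(Real.sin t) * ((derivative (legendreP n)).eval (Real.cos t) * -Real.sin t)

theorem hasDerivAt_legendreNormal (n : ℕ) {t : ℝ} (ht : 0 < Real.sin t) :
    HasDerivAt (legendreNormal n) (legendreNormalDeriv n t) t :=
  ((Real.hasDerivAt_sin t).sqrt ht.ne').mul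
    (((legendreP n).hasDerivAt _).comp t (Real.hasDerivAt_cos t))

theorem hasDerivAt_legendreNormalDeriv (n : ℕ) {t : ℝ} (ht : 0 < Real.sin t) :
    HasDerivAt (legendreNormalDeriv n)
      (-((n + 1 / 2 : ℝ) ^ 2 + 1 / (4 * Real.sin t ^ 2)) * legendreNormal n t) t := by
  have hs : 0 < √(Real.sin t) := Real.sqrt_pos.2 ht
  have hsq : √(Real.sin t) ^ 2 = Real.sin t := Real.sq_sqrt ht.le
  have hd := (Real.hasDerivAt_sin t).sqrt ht.ne'
  have h1 := (((Real.hasDerivAt_cos t).div (hd.const_mul 2) (by positivity)).mul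
    (((legendreP n).hasDerivAt _).comp t (Real.hasDerivAt_cos t))).add
    (hd.mul ((((derivative (legendreP n)).hasDerivAt _).comp t (Real.hasDerivAt_cos t)).mul
      (Real.hasDerivAt_sin t).neg))
  refine h1.congr_deriv ?_
  have h2 := congrArg (eval (Real.cos t)) (legendreP_ode n)
  simp only [eval_add, eval_sub, eval_mul, eval_pow, eval_X, eval_one, eval_C, eval_ofNat,
    eval_zero] at h2
  have h3 := Real.sin_sq_add_cos_sq t
  simp only [legendreNormal, Function.comp, Pi.mul_apply, Pi.div_apply, Pi.neg_apply]
  -- With `sin t = s²`, the claim becomes an algebraic identity in `s` and `c`, modulo Legendre's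
  -- equation and `s⁴ + c² = 1`.
  set s := √(Real.sin t)
  rw [← hsq] at h3 ⊢
  set c := Real.cos t
  set p := (legendreP n).eval c
  set p1 := (derivative (legendreP n)).eval c
  set p2 := (derivative (derivative (legendreP n))).eval c
  have h4 : 1 - c ^ 2 = s ^ 4 := by linear_combination -h3
  rw [h4] at h2
  field_simp
  linear_combination (16 * s ^ 4) * h2 - 4 * p * h3

/-! ### Sturm comparison -/

/-- Sturm comparison: an upper bound for the gap between zeros. -/
theorem sturm_gap_le {u u' Q : ℝ → ℝ} {α β w : ℝ} (hw : 0 < w)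
    (h1 : ∀ x ∈ Set.Icc α β, HasDerivAt u (u' x) x)
    (h2 : ∀ x ∈ Set.Icc α β, HasDerivAt u' (-Q x * u x) x)
    (hQ : ∀ x ∈ Set.Icc α β, w ^ 2 ≤ Q x) (hα : u α = 0) (hpos : ∀ x ∈ Set.Ioo α β, 0 < u x) :
    β - α ≤ Real.pi / w := by
  by_contra! hlt
  have hpw : 0 < Real.pi / w := by positivity
  set γ := α + Real.pi / w
  have hγ : γ < β := by linarith
  have hαγ : α < γ := by linarith
  have hsub : Set.Icc α γ ⊆ Set.Icc α β := Set.Icc_subset_Icc_right hγ.le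
  -- The Wronskian with `sin (w (x - α))` decreases from `0` at `α`, yet equals `w * u γ > 0` at
  -- `γ`.
  have hW : ∀ x ∈ Set.Icc α γ, HasDerivAt
      (fun x => u' x * Real.sin (w * (x - α)) - u x * (w * Real.cos (w * (x - α))))
      ((w ^ 2 - Q x) * (u x * Real.sin (w * (x - α)))) x := by
    intro x hx
    have hl : HasDerivAt (fun x => w * (x - α)) w x := by
      simpa using ((hasDerivAt_id x).sub_const α).const_mul w
    exact (((h2 x (hsub hx)).mul hl.sin).sub ((h1 x (hsub hx)).mul (hl.cos.const_mul w))).congr_deriv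
      (by ring)
  have hanti := antitoneOn_of_deriv_nonpos (convex_Icc α γ)
    (fun x hx => (hW x hx).continuousAt.continuousWithinAt)
    (fun x hx => (hW x (interior_subset hx)).differentiableAt.differentiableWithinAt)
    (by
      intro x hx
      rw [(hW x (interior_subset hx)).deriv]
      rw [interior_Icc] at hx
      have hs : 0 ≤ Real.sin (w * (x - α)) := by
        refine Real.sin_nonneg_of_nonneg_of_le_pi (mul_nonneg hw.le (by linarith [hx.1])) ?_
        have : x - α ≤ Real.pi / w := by linarith [hx.2]
        rw [le_div_iff₀ hw] at this
        linarith
      exact mul_nonpos_of_nonpos_of_nonneg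
        (by linarith [hQ x (hsub (Set.Ioo_subset_Icc_self hx))])
        (mul_nonneg (hpos x ⟨hx.1, hx.2.trans hγ⟩).le hs))
  have h := hanti (Set.left_mem_Icc.2 hαγ.le) (Set.right_mem_Icc.2 hαγ.le) hαγ.le
  have he : w * (γ - α) = Real.pi := by simp only [γ]; field_simp; ring
  simp only [he, sub_self, mul_zero, Real.sin_zero, hα, Real.sin_pi, Real.cos_pi] at h
  nlinarith [mul_pos (hpos γ ⟨hαγ, hγ⟩) hw]

/-- Sturm comparison: a lower bound for the gap between zeros. -/
theorem le_sturm_gap {u u' Q : ℝ → ℝ} {α β m : ℝ} (hm : 0 < m) (hαβ : α < β)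
    (h1 : ∀ x ∈ Set.Icc α β, HasDerivAt u (u' x) x)
    (h2 : ∀ x ∈ Set.Icc α β, HasDerivAt u' (-Q x * u x) x)
    (hQ : ∀ x ∈ Set.Icc α β, Q x ≤ m ^ 2) (hα : u α = 0) (hβ : u β = 0)
    (hpos : ∀ x ∈ Set.Ioo α β, 0 < u x) :
    Real.pi / m ≤ β - α := by
  by_contra! hlt
  have hl : ∀ x, HasDerivAt (fun x => m * (x - α)) m x := fun x => by
    simpa using ((hasDerivAt_id x).sub_const α).const_mul m
  have hs : ∀ x ∈ Set.Ioc α β, 0 < Real.sin (m * (x - α)) := by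
    intro x hx
    refine Real.sin_pos_of_pos_of_lt_pi (mul_pos hm (by linarith [hx.1])) ?_
    have : x - α < Real.pi / m := by linarith [hx.2]
    rw [lt_div_iff₀ hm] at this
    linarith
  have hW : ∀ x ∈ Set.Icc α β, HasDerivAt
      (fun x => u' x * Real.sin (m * (x - α)) - u x * (m * Real.cos (m * (x - α))))
      ((m ^ 2 - Q x) * (u x * Real.sin (m * (x - α)))) x := by
    intro x hx
    exact (((h2 x hx).mul (hl x).sin).sub ((h1 x hx).mul ((hl x).cos.const_mul m))).congr_deriv
      (by ring)
  have hmono := monotoneOn_of_deriv_nonneg (convex_Icc α β)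
    (fun x hx => (hW x hx).continuousAt.continuousWithinAt)
    (fun x hx => (hW x (interior_subset hx)).differentiableAt.differentiableWithinAt)
    (by
      intro x hx
      rw [(hW x (interior_subset hx)).deriv]
      rw [interior_Icc] at hx
      exact mul_nonneg (by linarith [hQ x (Set.Ioo_subset_Icc_self hx)])
        (mul_nonneg (hpos x hx).le (hs x ⟨hx.1, hx.2.le⟩).le))
  set γ := (α + β) / 2
  have hγ : γ ∈ Set.Ioo α β := ⟨by simp only [γ]; linarith, by simp only [γ]; linarith⟩
  have hsub : ∀ x ∈ Set.Icc γ β, x ∈ Set.Ioc α β := fun x hx => ⟨hγ.1.trans_le hx.1, hx.2⟩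
  -- The Wronskian is nonnegative, so this quotient increases; but it is positive at `γ` and zero at
  -- `β`. Using the quotient avoids needing `u' β ≠ 0`, and starting at the midpoint avoids the zero
  -- of the sine at `α`.
  have hR : ∀ x ∈ Set.Icc γ β, HasDerivAt (fun x => u x / Real.sin (m * (x - α)))
      ((u' x * Real.sin (m * (x - α)) - u x * (m * Real.cos (m * (x - α))))
        / Real.sin (m * (x - α)) ^ 2) x := by
    intro x hx
    have hx' := hsub x hx
    exact ((h1 x (Set.Ioc_subset_Icc_self hx')).div (hl x).sin (hs x hx').ne').congr_deriv
      (by ring)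
  have hmono2 := monotoneOn_of_deriv_nonneg (convex_Icc γ β)
    (fun x hx => (hR x hx).continuousAt.continuousWithinAt)
    (fun x hx => (hR x (interior_subset hx)).differentiableAt.differentiableWithinAt)
    (by
      intro x hx
      have hx' := hsub x (interior_subset hx)
      rw [(hR x (interior_subset hx)).deriv]
      refine div_nonneg ?_ (sq_nonneg _)
      have := hmono (Set.left_mem_Icc.2 hαβ.le) (Set.Ioc_subset_Icc_self hx') hx'.1.le
      simpa [hα] using this)
  have h := hmono2 (Set.left_mem_Icc.2 hγ.2.le) (Set.right_mem_Icc.2 hγ.2.le) hγ.2.le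
  have h0 := div_pos (hpos γ hγ) (hs γ ⟨hγ.1, hγ.2.le⟩)
  simp only [hβ, zero_div] at h
  linarith

/-! ### Symmetry and spacing of the zeros -/

theorem legendreZero_mem (n : ℕ) (i : Fin n) : legendreZero n i ∈ legendreZeroSet n :=
  (legendreZeroSet_finite n).mem_toFinset.1
    (Finset.orderEmbOfFin_mem _ (legendreZeroSet_card n) i)

theorem exists_legendreZero_eq {n : ℕ} {t : ℝ} (ht : t ∈ legendreZeroSet n) :
    ∃ i, legendreZero n i = t := by
  have h := Finset.range_orderEmbOfFin _ (legendreZeroSet_card n)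
  have : t ∈ Set.range (legendreZero n) := by
    rw [legendreZero, h]; simpa using ht
  exact this

/-- The zero set is invariant under `t ↦ π - t`, and its increasing enumeration is unique. -/
theorem legendreZero_rev (n : ℕ) (i : Fin n) :
    legendreZero n i.rev = Real.pi - legendreZero n i := by
  have h : (fun j : Fin n => Real.pi - legendreZero n j.rev) = legendreZero n := by
    refine Finset.orderEmbOfFin_unique _ (fun j => ?_) (fun j k hjk => ?_)
    · obtain ⟨⟨h1, h2⟩, h3⟩ := legendreZero_mem n j.rev
      simp only [Set.Finite.mem_toFinset]
      refine ⟨⟨by linarith, by linarith⟩, ?_⟩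
      rw [Real.cos_pi_sub]
      exact legendreP_eval_neg_eq_zero h3
    · have := (legendreZero n).strictMono (Fin.rev_lt_rev.2 hjk)
      show Real.pi - _ < Real.pi - _
      linarith
  have := congrFun h i.rev
  simpa using this.symm

theorem legendreNormal_legendreZero (n : ℕ) (i : Fin n) :
    legendreNormal n (legendreZero n i) = 0 := by
  rw [legendreNormal, (legendreZero_mem n i).2, mul_zero]

/-- Between two consecutive zeros, the normal form has a constant sign. -/
theorem legendreNormal_sign_between (n i : ℕ) (hi : i + 1 < n) :
    ∃ s : ℝ, ∀ x ∈ Set.Ioo (legendreZero n ⟨i, by omega⟩) (legendreZero n ⟨i + 1, hi⟩),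
      0 < s * legendreNormal n x := by
  set α := legendreZero n ⟨i, by omega⟩ with hα
  set β := legendreZero n ⟨i + 1, hi⟩ with hβ
  have hlt : α < β := (legendreZero n).strictMono (by simp [Fin.lt_def])
  have h0 : 0 < α := (legendreZero_mem n _).1.1
  have h1 : β < Real.pi := (legendreZero_mem n _).1.2
  have hsin : ∀ x ∈ Set.Ioo α β, 0 < Real.sin x := fun x hx =>
    Real.sin_pos_of_pos_of_lt_pi (h0.trans hx.1) (hx.2.trans h1)
  have hne : ∀ x ∈ Set.Ioo α β, legendreNormal n x ≠ 0 := by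
    intro x hx h
    have h2 := (mul_eq_zero.1 h).resolve_left (Real.sqrt_pos.2 (hsin x hx)).ne'
    obtain ⟨k, rfl⟩ := exists_legendreZero_eq (n := n) (t := x)
      ⟨⟨h0.trans hx.1, hx.2.trans h1⟩, h2⟩
    have h3 := (legendreZero n).lt_iff_lt.1 hx.1
    have h4 := (legendreZero n).lt_iff_lt.1 hx.2
    simp only [Fin.lt_def] at h3 h4
    omega
  set γ := (α + β) / 2
  have hγ : γ ∈ Set.Ioo α β := ⟨by simp only [γ]; linarith, by simp only [γ]; linarith⟩
  refine ⟨legendreNormal n γ, fun x hx => ?_⟩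
  by_contra! hle
  have hcont : ContinuousOn (fun x => legendreNormal n γ * legendreNormal n x) (Set.Ioo α β) :=
    fun y hy => ((hasDerivAt_legendreNormal n (hsin y hy)).continuousAt.const_mul
      _).continuousWithinAt
  obtain ⟨y, hy, hy0⟩ := isPreconnected_Ioo.intermediate_value hx hγ hcont
    ⟨hle, (mul_self_pos.2 (hne γ hγ)).le⟩
  exact mul_ne_zero (hne γ hγ) (hne y hy) hy0

/-- The factor `s` makes the solution positive on a given gap, as the comparison lemmas require. -/
theorem hasDerivAt_const_mul_legendreNormal (n : ℕ) (s : ℝ) {t : ℝ} (ht : 0 < Real.sin t) :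
    HasDerivAt (fun x => s * legendreNormal n x) (s * legendreNormalDeriv n t) t ∧
    HasDerivAt (fun x => s * legendreNormalDeriv n x)
      (-((n + 1 / 2 : ℝ) ^ 2 + 1 / (4 * Real.sin t ^ 2)) * (s * legendreNormal n t)) t :=
  ⟨(hasDerivAt_legendreNormal n ht).const_mul s,
    ((hasDerivAt_legendreNormalDeriv n ht).const_mul s).congr_deriv (by ring)⟩

theorem legendreZero_gap_le (n i : ℕ) (hi : i + 1 < n) :
    legendreZero n ⟨i + 1, hi⟩ - legendreZero n ⟨i, by omega⟩ ≤ Real.pi / (n + 1 / 2) := by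
  obtain ⟨s, hs⟩ := legendreNormal_sign_between n i hi
  have hsin : ∀ x ∈ Set.Icc (legendreZero n ⟨i, by omega⟩) (legendreZero n ⟨i + 1, hi⟩),
      0 < Real.sin x := fun x hx => Real.sin_pos_of_pos_of_lt_pi
    ((legendreZero_mem n _).1.1.trans_le hx.1) (hx.2.trans_lt (legendreZero_mem n _).1.2)
  exact sturm_gap_le (by positivity)
    (fun x hx => (hasDerivAt_const_mul_legendreNormal n s (hsin x hx)).1)
    (fun x hx => (hasDerivAt_const_mul_legendreNormal n s (hsin x hx)).2)
    (fun x _ => le_add_of_nonneg_right (by positivity))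
    (by simp [legendreNormal_legendreZero]) hs

theorem sin_le_sin_of_mem_Icc {c x : ℝ} (hc : 0 < c) (hx : x ∈ Set.Icc c (Real.pi - c)) :
    Real.sin c ≤ Real.sin x := by
  have hc2 : c ≤ Real.pi / 2 := by linarith [hx.1, hx.2]
  rcases le_total x (Real.pi / 2) with h | h
  · exact Real.sin_le_sin_of_le_of_le_pi_div_two (by linarith) h hx.1
  · rw [← Real.sin_pi_sub x]
    exact Real.sin_le_sin_of_le_of_le_pi_div_two (by linarith) (by linarith) (by linarith [hx.2])

/-- The potential blows up at `0` and `π`, so an upper bound for it needs the distance `c` from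
both. -/
theorem le_legendreZero_gap (n i : ℕ) (hi : i + 1 < n) {c : ℝ} (hc : 0 < c)
    (h1 : c ≤ legendreZero n ⟨i, by omega⟩) (h2 : legendreZero n ⟨i + 1, hi⟩ ≤ Real.pi - c) :
    Real.pi / √((n + 1 / 2 : ℝ) ^ 2 + 1 / (4 * Real.sin c ^ 2))
      ≤ legendreZero n ⟨i + 1, hi⟩ - legendreZero n ⟨i, by omega⟩ := by
  obtain ⟨s, hs⟩ := legendreNormal_sign_between n i hi
  have hlt : legendreZero n ⟨i, by omega⟩ < legendreZero n ⟨i + 1, hi⟩ :=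
    (legendreZero n).strictMono (by simp [Fin.lt_def])
  have hsc : 0 < Real.sin c := Real.sin_pos_of_pos_of_lt_pi hc (by linarith)
  have hsin : ∀ x ∈ Set.Icc (legendreZero n ⟨i, by omega⟩) (legendreZero n ⟨i + 1, hi⟩),
      Real.sin c ≤ Real.sin x := fun x hx =>
    sin_le_sin_of_mem_Icc hc ⟨h1.trans hx.1, hx.2.trans h2⟩
  refine le_sturm_gap (by positivity) hlt
    (fun x hx => (hasDerivAt_const_mul_legendreNormal n s (hsc.trans_le (hsin x hx))).1)
    (fun x hx => (hasDerivAt_const_mul_legendreNormal n s (hsc.trans_le (hsin x hx))).2)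
    (fun x hx => ?_)
    (by simp [legendreNormal_legendreZero]) (by simp [legendreNormal_legendreZero]) hs
  rw [Real.sq_sqrt (by positivity)]
  have := hsin x hx
  gcongr

theorem legendreZero_sub_le (n i d : ℕ) (hi : i + d < n) :
    legendreZero n ⟨i + d, hi⟩ - legendreZero n ⟨i, by omega⟩ ≤ d * (Real.pi / (n + 1 / 2)) := by
  induction d with
  | zero => simp
  | succ d ih =>
    have h1 := ih (by omega)
    have h2 := legendreZero_gap_le n (i + d) hi
    push_cast
    simp only [← add_assoc]
    linarith

theorem le_legendreZero_sub (n i d : ℕ) (hi : i + d < n) {c : ℝ} (hc : 0 < c)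
    (h1 : c ≤ legendreZero n ⟨i, by omega⟩) (h2 : legendreZero n ⟨i + d, hi⟩ ≤ Real.pi - c) :
    d * (Real.pi / √((n + 1 / 2 : ℝ) ^ 2 + 1 / (4 * Real.sin c ^ 2)))
      ≤ legendreZero n ⟨i + d, hi⟩ - legendreZero n ⟨i, by omega⟩ := by
  induction d with
  | zero => simp
  | succ d ih =>
    have hle : legendreZero n ⟨i + d, by omega⟩ ≤ legendreZero n ⟨i + (d + 1), hi⟩ :=
      (legendreZero n).monotone (by simp [Fin.le_def])
    have hle2 : legendreZero n ⟨i, by omega⟩ ≤ legendreZero n ⟨i + d, by omega⟩ :=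
      (legendreZero n).monotone (by simp [Fin.le_def])
    have h3 := ih (by omega) h1 (hle.trans h2)
    have h4 := le_legendreZero_gap n (i + d) hi hc (h1.trans hle2) h2
    push_cast
    simp only [← add_assoc] at h4 ⊢
    linarith

/-! ### Distance to the Laplace zeros -/

theorem pi_div_sub_pi_div_sqrt_le {w M : ℝ} (hw : 0 < w) (hM : 0 ≤ M) :
    Real.pi / w - Real.pi / √(w ^ 2 + M) ≤ Real.pi * M / w ^ 3 := by
  set m := √(w ^ 2 + M) with hm
  have hwm : w ≤ m := Real.le_sqrt_of_sq_le (by linarith)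
  have hm2 : m ^ 2 = w ^ 2 + M := Real.sq_sqrt (by positivity)
  have hm0 : 0 < m := hw.trans_le hwm
  have e : Real.pi / w - Real.pi / m = Real.pi * M / (w * (m * (m + w))) := by
    have : M = (m - w) * (m + w) := by linarith
    rw [this]; field_simp
  rw [e, show w ^ 3 = w * (w * w) by ring]
  have := Real.pi_pos
  gcongr
  linarith

/-- Comparison of a zero in the left half with the zero of the Laplace approximation. -/
theorem abs_legendreZero_sub_laplaceZero_le_of_le (n i d : ℕ) (hn : 2 * i + d + 1 = n) {c : ℝ}
    (hc : 0 < c) (h1 : c ≤ legendreZero n ⟨i, by omega⟩) :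
    |legendreZero n ⟨i, by omega⟩ - laplaceZero n (i + 1)|
      ≤ Real.pi / (4 * Real.sin c ^ 2) / n ^ 2 := by
  -- By `hn`, the mirror image of zero `i` lies exactly `d` gaps to its right.
  have hrev : legendreZero n ⟨i + d, by omega⟩ = Real.pi - legendreZero n ⟨i, by omega⟩ := by
    rw [← legendreZero_rev]
    congr 1
    simp only [Fin.rev, Fin.mk.injEq]
    omega
  have hU := legendreZero_sub_le n i d (by omega)
  have hL := le_legendreZero_sub n i d (by omega) hc h1 (by rw [hrev]; linarith)
  rw [hrev] at hU hL
  have hnR : (n : ℝ) = 2 * i + d + 1 := by rw [← hn]; push_cast; ring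
  have hlap : Real.pi - 2 * laplaceZero n (i + 1) = d * (Real.pi / (n + 1 / 2)) := by
    rw [laplaceZero, hnR]
    push_cast
    field_simp
    ring
  have hn0 : (0 : ℝ) < n := by rw [hnR]; positivity
  have hdn : (d : ℝ) ≤ n := by rw [hnR]; linarith [(Nat.cast_nonneg i : (0 : ℝ) ≤ i)]
  have hb := pi_div_sub_pi_div_sqrt_le (w := (n + 1 / 2 : ℝ)) (M := 1 / (4 * Real.sin c ^ 2))
    (by positivity) (by positivity)
  have hpi := Real.pi_pos
  have hd := mul_le_mul_of_nonneg_left hb (Nat.cast_nonneg d : (0 : ℝ) ≤ d)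
  have hf : d * (Real.pi * (1 / (4 * Real.sin c ^ 2)) / (n + 1 / 2 : ℝ) ^ 3)
      ≤ Real.pi / (4 * Real.sin c ^ 2) / n ^ 2 := by
    calc d * (Real.pi * (1 / (4 * Real.sin c ^ 2)) / (n + 1 / 2 : ℝ) ^ 3)
        ≤ n * (Real.pi * (1 / (4 * Real.sin c ^ 2)) / (n : ℝ) ^ 3) := by
          gcongr; linarith
      _ = _ := by field_simp
  have h0 : 0 ≤ Real.pi / (4 * Real.sin c ^ 2) / (n : ℝ) ^ 2 := by positivity
  rw [abs_le]
  constructor <;> linarith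

theorem abs_legendreZero_sub_laplaceZero_le (n : ℕ) (i : Fin n) {c : ℝ} (hc : 0 < c)
    (h : legendreZero n i ∈ Set.Icc c (Real.pi - c)) :
    |legendreZero n i - laplaceZero n (i + 1)| ≤ Real.pi / (4 * Real.sin c ^ 2) / n ^ 2 := by
  rcases le_total (2 * (i : ℕ) + 1) n with hi | hi
  · obtain ⟨d, hd⟩ := Nat.exists_eq_add_of_le hi
    exact abs_legendreZero_sub_laplaceZero_le_of_le n i d (by omega) hc h.1
  -- In the right half, reflect: the Laplace zeros have the same symmetry.
  · have hin := i.2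
    obtain ⟨d, hd⟩ := Nat.exists_eq_add_of_le hi
    have hr := legendreZero_rev n i
    have key := abs_legendreZero_sub_laplaceZero_le_of_le n i.rev d
      (by simp only [Fin.val_rev]; omega) hc (by
        show c ≤ legendreZero n i.rev
        rw [hr]; linarith [h.2])
    have hcast : (((i.rev : ℕ) + 1 : ℕ) : ℝ) = n - i := by
      rw [Fin.val_rev, eq_sub_iff_add_eq]
      norm_cast
      omega
    have hl : laplaceZero n ((i.rev : ℕ) + 1) = Real.pi - laplaceZero n (i + 1) := by
      rw [laplaceZero, laplaceZero, hcast]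
      push_cast
      field_simp
      ring
    rw [Fin.eta, hr, hl, show Real.pi - legendreZero n i - (Real.pi - laplaceZero n (i + 1))
      = -(legendreZero n i - laplaceZero n (i + 1)) by ring, abs_neg] at key
    exact key

/-! ### Cauchy's estimate and the sum -/

/-- Cauchy's estimate for the variation of a function bounded on `U`, near a point of a set whose
closed `δ`-thickening lies in `U`. -/
theorem norm_sub_le_of_cthickening_subset {S U : Set ℂ} {δ : ℝ} (hδ : 0 < δ)
    (hU : Metric.cthickening δ S ⊆ U) {f : ℂ → ℂ} (hf : AnalyticOnNhd ℂ f U)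
    (hbd : BddAbove ((fun z => ‖f z‖) '' U)) {z w : ℂ} (hz : z ∈ S) (hw : ‖z - w‖ ≤ δ / 2) :
    ‖f z - f w‖ ≤ supNormOn U f / (δ / 2) * ‖z - w‖ := by
  -- Half of `δ` is spent on moving away from `z`, the other half on the Cauchy circle.
  have hball : ∀ x ∈ Metric.closedBall z (δ / 2), Metric.closedBall x (δ / 2) ⊆ U := by
    intro x hx y hy
    refine hU (Metric.mem_cthickening_of_dist_le y z δ S hz ?_)
    have := dist_triangle y x z
    rw [Metric.mem_closedBall] at hx hy
    linarith
  have hxU : ∀ x ∈ Metric.closedBall z (δ / 2), x ∈ U := fun x hx =>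
    hball x hx (Metric.mem_closedBall_self (by positivity))
  have hw' : w ∈ Metric.closedBall z (δ / 2) := by
    rwa [Metric.mem_closedBall, dist_comm, dist_eq_norm]
  refine (convex_closedBall z (δ / 2)).norm_image_sub_le_of_norm_deriv_le
    (fun x hx => (hf x (hxU x hx)).differentiableAt) (fun x hx => ?_) hw'
    (Metric.mem_closedBall_self (by positivity))
  refine Complex.norm_deriv_le_of_forall_mem_sphere_norm_le (by positivity) ?_ (fun y hy => ?_)
  · refine DifferentiableOn.diffContOnCl fun y hy => ?_
    exact (hf y (hball x hx (Metric.closure_ball_subset_closedBall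
      hy))).differentiableAt.differentiableWithinAt
  · exact le_csSup hbd ⟨y, hball x hx (Metric.sphere_subset_closedBall hy), rfl⟩

/-- The closed interval `I` is `[a, b]`, and `U` is a complex neighbourhood of it. The constants
`K` and `N` depend on `I` and `U` only. The index `i : Fin n` stands for `j = i + 1`. -/
theorem theorem2 (a b : ℝ) (ha : 0 < a) (hab : a ≤ b) (hb : b < Real.pi)
    (U : Set ℂ) (hU : IsOpen U) (hIU : ∀ t ∈ Set.Icc a b, (t : ℂ) ∈ U) :
    ∃ (K : ℝ) (N : ℕ), ∀ n : ℕ, N ≤ n →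
      (∀ i : Fin n, legendreZero n i ∈ Set.Icc a b → (laplaceZero n (i + 1) : ℂ) ∈ U) ∧
      ∀ f : ℂ → ℂ, AnalyticOnNhd ℂ f U → BddAbove ((fun z => ‖f z‖) '' U) →
        ‖(∑ i : Fin n with legendreZero n i ∈ Set.Icc a b,
              (-1 : ℂ) ^ ((i : ℕ) + 1) * f (legendreZero n i)) -
            ∑ i : Fin n with legendreZero n i ∈ Set.Icc a b,
              (-1 : ℂ) ^ ((i : ℕ) + 1) * f (laplaceZero n (i + 1))‖
          ≤ K / n * supNormOn U f := by

  obtain ⟨δ, hδ, hδU⟩ := (isCompact_Icc (a := a) (b := b)).image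
    Complex.continuous_ofReal |>.exists_cthickening_subset_open hU (by
      rintro _ ⟨t, ht, rfl⟩; exact hIU t ht)
  set c := min a (Real.pi - b)
  have hc : 0 < c := lt_min ha (by linarith)
  have hsub : Set.Icc a b ⊆ Set.Icc c (Real.pi - c) := by
    intro t ht
    have h1 : c ≤ a := min_le_left _ _
    have h2 : c ≤ Real.pi - b := min_le_right _ _
    exact ⟨h1.trans ht.1, by linarith [ht.2]⟩
  set C := Real.pi / (4 * Real.sin c ^ 2)
  have hC : 0 ≤ C := div_nonneg Real.pi_pos.le (by positivity)
  -- This makes `C / n² ≤ δ / 2` for `n ≥ N + 1`; the extra `1` ensures `n ≥ 1`.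
  obtain ⟨N, hN⟩ := exists_nat_gt (C / (δ / 2))
  refine ⟨C / (δ / 2), N + 1, fun n hn => ?_⟩
  have hn1 : (1 : ℝ) ≤ n := by exact_mod_cast (by omega : 1 ≤ n)
  have hn0 : (0 : ℝ) < n := by linarith
  have hNn : (N : ℝ) ≤ n := by exact_mod_cast (by omega : N ≤ n)
  have hdist : ∀ i : Fin n, legendreZero n i ∈ Set.Icc a b →
      ‖(legendreZero n i : ℂ) - laplaceZero n (i + 1)‖ ≤ C / n ^ 2 := by
    intro i hi
    rw [← Complex.ofReal_sub, Complex.norm_real]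
    exact abs_legendreZero_sub_laplaceZero_le n i hc (hsub hi)
  have hsmall : C / (n : ℝ) ^ 2 ≤ δ / 2 := by
    rw [div_lt_iff₀ (by positivity)] at hN
    rw [div_le_iff₀ (by positivity)]
    have : (N : ℝ) ≤ n ^ 2 := by nlinarith
    nlinarith
  have hmem : ∀ i : Fin n, legendreZero n i ∈ Set.Icc a b →
      (legendreZero n i : ℂ) ∈ ((↑) : ℝ → ℂ) '' Set.Icc a b := fun i hi => ⟨_, hi, rfl⟩
  refine ⟨fun i hi => hδU (Metric.mem_cthickening_of_dist_le _ _ δ _ (hmem i hi) ?_), ?_⟩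
  · rw [dist_comm, dist_eq_norm]
    linarith [hdist i hi]
  intro f hf hbd
  have hS : 0 ≤ supNormOn U f :=
    (norm_nonneg _).trans (le_csSup hbd ⟨_, hIU a (Set.left_mem_Icc.2 hab), rfl⟩)
  rw [← Finset.sum_sub_distrib]
  have hterm : ∀ i ∈ Finset.univ.filter (fun i : Fin n => legendreZero n i ∈ Set.Icc a b),
      ‖(-1 : ℂ) ^ ((i : ℕ) + 1) * f (legendreZero n i)
        - (-1 : ℂ) ^ ((i : ℕ) + 1) * f (laplaceZero n (i + 1))‖
      ≤ supNormOn U f / (δ / 2) * (C / n ^ 2) := by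
    intro i hi
    have hi' := (Finset.mem_filter.1 hi).2
    rw [← mul_sub, norm_mul, norm_pow, norm_neg, norm_one, one_pow, one_mul]
    refine (norm_sub_le_of_cthickening_subset hδ hδU hf hbd (hmem i hi')
      ((hdist i hi').trans hsmall)).trans ?_
    gcongr
    exact hdist i hi'
  refine (norm_sum_le_of_le _ hterm).trans ?_
  rw [Finset.sum_const, nsmul_eq_mul]
  have hcard : ((Finset.univ.filter
      (fun i : Fin n => legendreZero n i ∈ Set.Icc a b)).card : ℝ) ≤ n := by
    exact_mod_cast (Finset.card_filter_le _ _).trans (by simp)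
  calc _ ≤ (n : ℝ) * (supNormOn U f / (δ / 2) * (C / n ^ 2)) := by gcongr
    _ = C / (δ / 2) / n * supNormOn U f := by field_simp
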